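/- Let $n \ge 1$ be an integer and let $$V_{8n} = \langle a, b : a^{2n} = b^4 = 1,\ ba = a^{-1}b^{-1},\ b^{-1}a = a^{-1}b \rangle,$$ a finite group. For a group $G$ and an equivalence relation $B$ on $G$, with classes denoted $[g]$, the $B$ super commuting graph on $G$ is the simple graph with vertex set $G$ in which two distinct vertices $g, h$ are adjacent if and only if $[g] = [h]$ or there exist $g' \in [g]$ and $h' \in [h]$ with $g'h' = h'g'$. Let $\mathrm{ESCom}(G)$, $\mathrm{CSCom}(G)$ and $\mathrm{OSCom}(G)$ be the graphs obtained when $B$ is, respectively, equality, conjugacy in $G$, and the relation of having the same order. For a finite simple graph $\Gamma$ with vertex set $v(\Gamma)$ and edge set $e(\Gamma)$ put $$M_1(\Gamma) = \sum_{v \in v(\Gamma)} \deg(v)^2, \qquad M_2(\Gamma) = \sum_{uv \in e(\Gamma)} \deg(u)\deg(v).$$ Then for each of the three graphs $\Gamma = \mathrm{ESCom}(V_{8n})$, $\mathrm{CSCom}(V_{8n})$, $\mathrm{OSCom}(V_{8n})$ the Hansen–Vukičević inequality holds: $$\frac{M_2(\Gamma)}{|e(\Gamma)|} \ge \frac{M_1(\Gamma)}{|v(\Gamma)|}.$$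 -/

import Mathlib

/-- The relators, on generators `a = of 0` and `b = of 1`, of the presentation
`⟨a, b : a ^ (2n) = b ^ 4 = 1, b a = a⁻¹ b⁻¹, b⁻¹ a = a⁻¹ b⟩`. A relation `u = v` is written as the
relator `u * v⁻¹`. -/
def V8nRels (n : ℕ) : Set (FreeGroup (Fin 2)) :=
  let a : FreeGroup (Fin 2) := FreeGroup.of 0
  let b : FreeGroup (Fin 2) := FreeGroup.of 1
  {a ^ (2 * n), b ^ 4, (b * a) * (a⁻¹ * b⁻¹)⁻¹, (b⁻¹ * a) * (a⁻¹ * b)⁻¹}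

/-- The group `V_{8n}`. -/
abbrev V8n (n : ℕ) : Type := PresentedGroup (V8nRels n)

/-- `V_{8n}` is finite for `n ≥ 1`, since every element has the form `a ^ i * b ^ j`. -/
instance V8n.instFinite (n : ℕ) [NeZero n] : Finite (V8n n) := by
  have hrel : ∀ r ∈ V8nRels n, PresentedGroup.mk (V8nRels n) r = 1 := fun r hr =>
    PresentedGroup.one_of_mem hr
  obtain ⟨a, ha⟩ : ∃ a : V8n n, a = PresentedGroup.of 0 := ⟨_, rfl⟩
  obtain ⟨b, hb⟩ : ∃ b : V8n n, b = PresentedGroup.of 1 := ⟨_, rfl⟩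
  have h1 : a ^ (2 * n) = 1 := by
    have := hrel (FreeGroup.of 0 ^ (2 * n)) (by simp [V8nRels])
    rw [map_pow] at this
    rw [ha]; exact this
  have h2 : b ^ 4 = 1 := by
    have := hrel (FreeGroup.of 1 ^ 4) (by simp [V8nRels])
    rw [map_pow] at this
    rw [hb]; exact this
  have h3 : b * a = a⁻¹ * b⁻¹ := by
    have := hrel ((FreeGroup.of 1 * FreeGroup.of 0) *
      ((FreeGroup.of 0)⁻¹ * (FreeGroup.of 1)⁻¹)⁻¹) (by simp [V8nRels])
    rw [map_mul, map_inv, mul_inv_eq_one, map_mul, map_mul, map_inv, map_inv] at this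
    rw [ha, hb]; exact this
  have h4 : b⁻¹ * a = a⁻¹ * b := by
    have := hrel (((FreeGroup.of 1)⁻¹ * FreeGroup.of 0) *
      ((FreeGroup.of 0)⁻¹ * FreeGroup.of 1)⁻¹) (by simp [V8nRels])
    rw [map_mul, map_inv, mul_inv_eq_one, map_mul, map_mul, map_inv, map_inv] at this
    rw [ha, hb]; exact this
  have hc : Commute a (b ^ 2) := by
    have e1 : b * a * b = a⁻¹ := by rw [h3]; group
    have e2 : b⁻¹ * a * b⁻¹ = a⁻¹ := by rw [h4]; group
    have e3 : b ^ 2 * a * b ^ 2 = a := by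
      calc b ^ 2 * a * b ^ 2 = b * (b * a * b) * b := by simp only [pow_two, mul_assoc]
        _ = b * (b⁻¹ * a * b⁻¹) * b := by rw [e1, e2]
        _ = a := by group
    have e4 : b ^ 2 * b ^ 2 = 1 := by rw [← pow_add]; exact h2
    change a * b ^ 2 = b ^ 2 * a
    calc a * b ^ 2 = b ^ 2 * a * b ^ 2 * b ^ 2 := by rw [e3]
      _ = b ^ 2 * a * (b ^ 2 * b ^ 2) := by group
      _ = b ^ 2 * a := by rw [e4, mul_one]
  have hconj : b * a * b⁻¹ = a⁻¹ * (b ^ 2)⁻¹ := by rw [h3]; group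
  have hstep : ∀ i j : ℤ, b * (a ^ i * b ^ j) = a ^ (-i) * b ^ (-2 * i + 1 + j) := by
    intro i j
    have : b * a ^ i * b⁻¹ = a ^ (-i) * b ^ (-2 * i) := by
      rw [← conj_zpow, hconj, (hc.inv_inv).mul_zpow, inv_zpow', inv_zpow',
        ← zpow_natCast, ← zpow_mul]
      congr 2
      push_cast
      ring
    calc b * (a ^ i * b ^ j) = (b * a ^ i * b⁻¹) * (b ^ (1 : ℤ) * b ^ j) := by
          rw [zpow_one]; group
      _ = _ := by rw [this, mul_assoc, ← zpow_add, ← zpow_add, add_assoc]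
  have hform : ∀ x : V8n n, ∃ i j : ℤ, x = a ^ i * b ^ j := by
    have hmemS : ∀ x ∈ Submonoid.closure ({a, b} : Set (V8n n)), ∃ i j : ℤ, x = a ^ i * b ^ j := by
      intro x hx
      induction hx using Submonoid.closure_induction_left with
      | one => exact ⟨0, 0, by simp⟩
      | mul_left y hy z _ ih =>
        obtain ⟨i, j, rfl⟩ := ih
        rcases hy with rfl | rfl
        · exact ⟨1 + i, j, by rw [zpow_add, zpow_one, mul_assoc]⟩
        · exact ⟨_, _, hstep i j⟩
    intro x
    apply hmemS
    have hainv : a⁻¹ ∈ Submonoid.closure ({a, b} : Set (V8n n)) := by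
      have : a⁻¹ = a ^ (2 * n - 1) := by
        rw [inv_eq_iff_mul_eq_one, ← pow_succ']
        have : 2 * n - 1 + 1 = 2 * n := by have := NeZero.ne n; omega
        rw [this, h1]
      rw [this]
      exact pow_mem (Submonoid.subset_closure (by simp)) _
    have hbinv : b⁻¹ ∈ Submonoid.closure ({a, b} : Set (V8n n)) := by
      have : b⁻¹ = b ^ 3 := by rw [inv_eq_iff_mul_eq_one, ← pow_succ', h2]
      rw [this]
      exact pow_mem (Submonoid.subset_closure (by simp)) _
    have htop : x ∈ Subgroup.closure (Set.range (PresentedGroup.of (rels := V8nRels n))) := by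
      rw [PresentedGroup.closure_range_of]; trivial
    induction htop using Subgroup.closure_induction'' with
    | one => exact one_mem _
    | mem y hy =>
      obtain ⟨k, rfl⟩ := hy
      fin_cases k
      · exact Submonoid.subset_closure (by simp [ha])
      · exact Submonoid.subset_closure (by simp [hb])
    | inv_mem y hy =>
      obtain ⟨k, rfl⟩ := hy
      fin_cases k
      · simpa [ha] using hainv
      · simpa [hb] using hbinv
    | mul y z _ _ hy hz => exact mul_mem hy hz
  have fa : Finite (Subgroup.zpowers a) := by
    refine Set.Finite.to_subtype (finite_zpowers.2 (isOfFinOrder_iff_pow_eq_one.2 ?_))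
    exact ⟨2 * n, by have := NeZero.ne n; omega, h1⟩
  have fb : Finite (Subgroup.zpowers b) := by
    refine Set.Finite.to_subtype (finite_zpowers.2 (isOfFinOrder_iff_pow_eq_one.2 ?_))
    exact ⟨4, by omega, h2⟩
  refine Finite.of_surjective
    (fun p : Subgroup.zpowers a × Subgroup.zpowers b => (p.1 : V8n n) * (p.2 : V8n n)) ?_
  intro x
  obtain ⟨i, j, rfl⟩ := hform x
  exact ⟨(⟨a ^ i, i, rfl⟩, ⟨b ^ j, j, rfl⟩), rfl⟩

noncomputable instance V8n.instFintype (n : ℕ) [NeZero n] : Fintype (V8n n) := Fintype.ofFinite _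

/-- The `B` super commuting graph on a group `G`, for an equivalence relation `B` on `G`: distinct
`g`, `h` are adjacent if `[g] = [h]` or some `g' ∈ [g]` commutes with some `h' ∈ [h]`. -/
def superCommGraph {G : Type*} [Group G] (B : Setoid G) : SimpleGraph G where
  Adj g h := g ≠ h ∧ (B g h ∨ ∃ g' h' : G, B g g' ∧ B h h' ∧ g' * h' = h' * g')
  symm := ⟨fun _ _ ⟨hne, H⟩ => ⟨hne.symm, H.imp B.symm
    fun ⟨g', h', hg, hh, hc⟩ => ⟨h', g', hh, hg, hc.symm⟩⟩⟩
  loopless := ⟨fun _ H => H.1 rfl⟩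

/-- The equality super commuting graph; `⊥` is the equality relation. -/
def ESCom (G : Type*) [Group G] : SimpleGraph G := superCommGraph (⊥ : Setoid G)

/-- The conjugacy super commuting graph. -/
def CSCom (G : Type*) [Group G] : SimpleGraph G := superCommGraph (IsConj.setoid G)

/-- The order super commuting graph: `g` and `h` are equivalent if they have the same order. -/
noncomputable def OSCom (G : Type*) [Group G] : SimpleGraph G :=
  superCommGraph (Setoid.ker (orderOf : G → ℕ))

open Classical in
/-- The first Zagreb index `M₁(Γ) = ∑_{v} deg(v)²`. -/
noncomputable def firstZagreb {V : Type*} [Fintype V] (Γ : SimpleGraph V) : ℕ :=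
  ∑ v : V, Γ.degree v ^ 2

open Classical in
/-- The second Zagreb index `M₂(Γ) = ∑_{uv ∈ e(Γ)} deg(u) deg(v)`, summed over unordered edges. -/
noncomputable def secondZagreb {V : Type*} [Fintype V] (Γ : SimpleGraph V) : ℕ :=
  ∑ e ∈ Γ.edgeFinset,
    Sym2.lift ⟨fun u v => Γ.degree u * Γ.degree v, fun _ _ => Nat.mul_comm _ _⟩ e

open Classical in
/-- The Hansen–Vukičević inequality `M₂(Γ) / |e(Γ)| ≥ M₁(Γ) / |v(Γ)|`. -/
def HansenVukicevic {V : Type*} [Fintype V] (Γ : SimpleGraph V) : Prop :=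
  (secondZagreb Γ : ℝ) / (Γ.edgeFinset.card : ℝ) ≥ (firstZagreb Γ : ℝ) / (Fintype.card V : ℝ)

/-! All three graphs are joins of a nonempty complete graph on a set `C` with a disjoint union of
complete graphs, and every such graph satisfies the inequality.

For the graph part, let `N` be the number of vertices, `c = |C|`, and let `T k` be the sum of `d ^
k` over the degrees `d` off `C`. Vertices of `C` have degree `N - 1`, and off `C` degrees are
constant on cliques, so `M₁`, `M₂` and the edge count are expressions in `N`, `c` and `T`. They give
`2 (M₂ N - M₁ |e|) = (T 0 T 3 - T 1 T 2) + c ∑ (N - 1 - d)² (d - 1)`, the last sum running over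
vertices off `C`. The first term is nonnegative by Chebyshev's sum inequality, the second because
each such vertex is joined to `C`, whence `d ≥ 1`.

For the group part, `⟨a, b²⟩` is abelian of index at most two, elements outside it have fourth power
1, and `b²` is a central involution. The set `C` is the center for `ESCom` and `CSCom`, and the set
of elements of order at most two for `OSCom`. -/

open Classical in
/-- Twice the second Zagreb index, as a sum over ordered pairs of adjacent vertices. -/
theorem two_mul_secondZagreb {V : Type*} [Fintype V] (Γ : SimpleGraph V) :
    2 * secondZagreb Γ = ∑ u, ∑ w ∈ Γ.neighborFinset u, Γ.degree u * Γ.degree w := by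
  set f : Sym2 V → ℕ :=
    Sym2.lift ⟨fun u v => Γ.degree u * Γ.degree v, fun _ _ => Nat.mul_comm _ _⟩ with hf
  have h1 : ∑ d : Γ.Dart, f d.edge = 2 * secondZagreb Γ := by
    rw [← Finset.sum_fiberwise_of_maps_to (s := Finset.univ) (t := Γ.edgeFinset)
      (g := fun d : Γ.Dart => d.edge)
      (fun d _ => by rw [SimpleGraph.mem_edgeFinset]; exact d.edge_mem), secondZagreb,
      Finset.mul_sum]
    -- Each edge underlies exactly two darts.
    refine Finset.sum_congr rfl fun e he => ?_
    rw [Finset.sum_congr rfl fun d hd => by rw [(Finset.mem_filter.1 hd).2], Finset.sum_const,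
      Γ.dart_edge_fiber_card e (SimpleGraph.mem_edgeFinset.1 he), smul_eq_mul]
  have h2 : ∑ d : Γ.Dart, f d.edge =
      ∑ u, ∑ w ∈ Γ.neighborFinset u, Γ.degree u * Γ.degree w := by
    rw [← Finset.sum_fiberwise (s := Finset.univ) (g := fun d : Γ.Dart => d.fst)]
    refine Finset.sum_congr rfl fun u _ => ?_
    refine Finset.sum_bij' (fun d _ => d.snd)
      (fun w hw => ⟨(u, w), (Γ.mem_neighborFinset u w).1 hw⟩) ?_ ?_ ?_ ?_ ?_
    · intro d hd
      have : d.fst = u := (Finset.mem_filter.1 hd).2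
      rw [SimpleGraph.mem_neighborFinset, ← this]
      exact d.adj
    · intro w hw
      simp
    · intro d hd
      have : d.fst = u := (Finset.mem_filter.1 hd).2
      subst this
      rfl
    · intro w hw
      rfl
    · intro d hd
      have : d.fst = u := (Finset.mem_filter.1 hd).2
      subst this
      rfl
  rw [← h1, h2]

open Classical in
/-- If a nonempty set `C` of vertices is joined to every vertex, and adjacency is transitive off
`C`, so that the graph is the join of a complete graph with a disjoint union of complete graphs,
then the Hansen–Vukičević inequality holds. -/
theorem hansenVukicevic_of_join_cliques {V : Type*} [Fintype V] (Γ : SimpleGraph V) (C : Finset V)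
    (hne : C.Nonempty) (hC : ∀ u ∈ C, ∀ v, u ≠ v → Γ.Adj u v)
    (htr : ∀ u v w, u ∉ C → v ∉ C → w ∉ C → Γ.Adj u v → Γ.Adj u w → v ≠ w → Γ.Adj v w) :
    HansenVukicevic Γ := by
  set d : V → ℝ := fun v => (Γ.degree v : ℝ) with hd
  set N : ℝ := (Fintype.card V : ℝ) with hN
  set c : ℝ := (C.card : ℝ) with hc
  have hc1 : 1 ≤ c := by rw [hc]; exact_mod_cast hne.card_pos
  have hdC : ∀ u ∈ C, d u = N - 1 := by
    intro u hu
    have : Γ.neighborFinset u = Finset.univ.erase u := by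
      ext v
      simp only [SimpleGraph.mem_neighborFinset, Finset.mem_erase, Finset.mem_univ, and_true]
      exact ⟨fun h => h.ne', fun h => hC u hu v h.symm⟩
    have h2 : Γ.degree u + 1 = Fintype.card V := by
      rw [← SimpleGraph.card_neighborFinset_eq_degree, this,
        Finset.card_erase_add_one (Finset.mem_univ u), Finset.card_univ]
    rw [hN, ← h2]; push_cast; ring
  have hsub : ∀ u w, u ∉ C → w ∉ C → Γ.Adj u w → Γ.degree u ≤ Γ.degree w := by
    intro u w hu hw huw
    -- Closed neighbourhoods are compared, since `u` and `w` lie in each other's neighbourhood but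
    -- not in their own; the extra element cancels in the cardinalities.
    have : insert u (Γ.neighborFinset u) ⊆ insert w (Γ.neighborFinset w) := by
      intro x hx
      simp only [Finset.mem_insert, SimpleGraph.mem_neighborFinset] at hx ⊢
      by_cases hxw : x = w
      · exact Or.inl hxw
      refine Or.inr ?_
      rcases hx with rfl | hx
      · exact huw.symm
      · by_cases hxC : x ∈ C
        · exact (hC x hxC w hxw).symm
        · exact htr u w x hu hw hxC huw hx (Ne.symm hxw)
    have := Finset.card_le_card this
    rw [Finset.card_insert_of_notMem (by simp), Finset.card_insert_of_notMem (by simp)] at this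
    simpa using this
  have hdeq : ∀ u w, u ∉ C → w ∉ C → Γ.Adj u w → d w = d u := by
    intro u w hu hw huw
    simp only [hd]
    exact_mod_cast le_antisymm (hsub w u hw hu huw.symm) (hsub u w hu hw huw)
  have hCsub : ∀ u, u ∉ C → C ⊆ Γ.neighborFinset u := by
    intro u hu x hx
    rw [SimpleGraph.mem_neighborFinset]
    exact (hC x hx u (by rintro rfl; exact hu hx)).symm
  have hcd : ∀ u, u ∉ C → c ≤ d u := by
    intro u hu
    have := Finset.card_le_card (hCsub u hu)
    rw [SimpleGraph.card_neighborFinset_eq_degree] at this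
    simp only [hc, hd]; exact_mod_cast this
  have hsC : ∀ u ∈ C, ∑ w ∈ Γ.neighborFinset u, d w = (∑ w, d w) - (N - 1) := by
    intro u hu
    have : Γ.neighborFinset u = Finset.univ.erase u := by
      ext v
      simp only [SimpleGraph.mem_neighborFinset, Finset.mem_erase, Finset.mem_univ, and_true]
      exact ⟨fun h => h.ne', fun h => hC u hu v h.symm⟩
    rw [this, Finset.sum_erase_eq_sub (Finset.mem_univ u), hdC u hu]
  -- The neighbours of `u` are the `c` vertices of `C`, of degree `N - 1`, and `d u - c` others in
  -- the clique of `u`, of degree `d u`.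
  have hsO : ∀ u, u ∉ C →
      ∑ w ∈ Γ.neighborFinset u, d w = c * (N - 1) + (d u - c) * d u := by
    intro u hu
    rw [← Finset.sum_sdiff (hCsub u hu), Finset.sum_congr rfl hdC, Finset.sum_const,
      Finset.sum_congr rfl (g := fun _ => d u), Finset.sum_const, nsmul_eq_mul, nsmul_eq_mul,
      Finset.card_sdiff_of_subset (hCsub u hu), Nat.cast_sub (Finset.card_le_card (hCsub u hu)),
      SimpleGraph.card_neighborFinset_eq_degree]
    · ring
    · intro w hw
      rw [Finset.mem_sdiff, SimpleGraph.mem_neighborFinset] at hw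
      exact hdeq u w hu hw.2 hw.1
  set T : ℕ → ℝ := fun k => ∑ u ∈ Cᶜ, d u ^ k with hT
  have hT0 : T 0 = N - c := by
    simp only [hT, pow_zero, Finset.sum_const, nsmul_eq_mul, mul_one]
    rw [Finset.card_compl, Nat.cast_sub (Finset.card_le_univ C)]
  have hS1 : ∑ u, d u = c * (N - 1) + T 1 := by
    rw [← Finset.sum_add_sum_compl C, Finset.sum_congr rfl hdC, Finset.sum_const, nsmul_eq_mul]
    simp [hT, hc]
  have hS2 : (firstZagreb Γ : ℝ) = c * (N - 1) ^ 2 + T 2 := by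
    rw [firstZagreb]
    push_cast
    rw [← Finset.sum_add_sum_compl C, Finset.sum_congr rfl fun u hu => by
      rw [show (Γ.degree u : ℝ) = N - 1 from hdC u hu], Finset.sum_const, nsmul_eq_mul]
  have hE : (2 : ℝ) * Γ.edgeFinset.card = c * (N - 1) + T 1 := by
    rw [← hS1]
    simp only [hd]
    exact_mod_cast Γ.sum_degrees_eq_twice_card_edges.symm
  have hM2 : 2 * (secondZagreb Γ : ℝ) = c * ((N - 1) * (c * (N - 1) + T 1 - (N - 1))) +
      (c * (N - 1) * T 1 + T 3 - c * T 2) := by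
    have h := congrArg (Nat.cast (R := ℝ)) (two_mul_secondZagreb Γ)
    push_cast at h
    rw [h, ← Finset.sum_add_sum_compl C]
    congr 1
    · rw [Finset.sum_congr rfl (g := fun _ => (N - 1) * (c * (N - 1) + T 1 - (N - 1))),
        Finset.sum_const, nsmul_eq_mul]
      intro u hu
      rw [← Finset.mul_sum, ← hS1, ← hsC u hu, ← hdC u hu]
    · simp only [hT, Finset.mul_sum (s := Cᶜ), ← Finset.sum_add_distrib,
        ← Finset.sum_sub_distrib]
      refine Finset.sum_congr rfl fun u hu => ?_
      rw [← Finset.mul_sum]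
      have := hsO u (Finset.mem_compl.1 hu)
      simp only [hd] at this ⊢
      rw [this]
      ring
  -- Chebyshev's sum inequality for the similarly ordered families `d` and `d ^ 2`.
  have hcheb : T 1 * T 2 ≤ T 0 * T 3 := by
    have hmono : MonovaryOn (fun u => d u) (fun u => d u ^ 2) (Cᶜ : Finset V) :=
      fun u _ v _ huv => (lt_of_pow_lt_pow_left₀ 2 (Nat.cast_nonneg _) huv).le
    have := hmono.sum_mul_sum_le_card_mul_sum
    have h3 : T 3 = ∑ u ∈ Cᶜ, d u * d u ^ 2 :=
      Finset.sum_congr rfl fun u _ => by ring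
    rw [h3]
    simpa [hT] using this
  -- This is the sum of `(N - 1 - d)² (d - 1)` off `C`, expanded.
  have hpoly : 0 ≤ T 3 - (2 * N - 1) * T 2 + (N - 1) * (N + 1) * T 1 - (N - 1) ^ 2 * T 0 := by
    simp only [hT, Finset.mul_sum, ← Finset.sum_add_distrib, ← Finset.sum_sub_distrib]
    refine Finset.sum_nonneg fun u hu => ?_
    have h1 : 1 ≤ d u := hc1.trans (hcd u (Finset.mem_compl.1 hu))
    have : 0 ≤ (N - 1 - d u) ^ 2 * (d u - 1) := mul_nonneg (sq_nonneg _) (by linarith)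
    linarith
  have hmain : (firstZagreb Γ : ℝ) * Γ.edgeFinset.card ≤ secondZagreb Γ * N := by
    have hk := mul_nonneg (by linarith : 0 ≤ c) hpoly
    have : 2 * ((secondZagreb Γ : ℝ) * N - firstZagreb Γ * Γ.edgeFinset.card) =
        (T 0 * T 3 - T 1 * T 2) + c * (T 3 - (2 * N - 1) * T 2 + (N - 1) * (N + 1) * T 1 -
          (N - 1) ^ 2 * T 0) := by
      rw [show 2 * ((secondZagreb Γ : ℝ) * N - firstZagreb Γ * Γ.edgeFinset.card) =
        (2 * secondZagreb Γ) * N - firstZagreb Γ * (2 * Γ.edgeFinset.card) by ring, hM2, hE, hS2,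
        hT0]
      ring
    linarith
  rw [HansenVukicevic, ge_iff_le]
  rcases Nat.eq_zero_or_pos Γ.edgeFinset.card with h0 | h0
  -- Without edges the left quotient is `0 / 0 = 0`, and `M₁` vanishes as well.
  · have hz : ∀ v, Γ.degree v = 0 := by
      have := Γ.sum_degrees_eq_twice_card_edges
      rw [h0, mul_zero, Finset.sum_eq_zero_iff] at this
      exact fun v => this v (Finset.mem_univ v)
    simp [firstZagreb, hz, h0]
  · have : 0 < Fintype.card V := Fintype.card_pos_iff.2 ⟨hne.choose⟩
    rw [div_le_div_iff₀ (by exact_mod_cast this) (by exact_mod_cast h0)]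
    exact hmain

/-! ### Groups with an abelian subgroup of index at most two -/

/-- An abelian subgroup of index at most two. -/
structure IsAbelianOfIndexLeTwo {G : Type*} [Group G] (N : Subgroup G) : Prop where
  comm : ∀ x ∈ N, ∀ y ∈ N, x * y = y * x
  mul_inv_mem : ∀ x ∉ N, ∀ y ∉ N, x * y⁻¹ ∈ N

namespace IsAbelianOfIndexLeTwo

variable {G : Type*} [Group G] {N : Subgroup G}

theorem normal (h : IsAbelianOfIndexLeTwo N) : N.Normal := by
  refine ⟨fun m hm g => ?_⟩
  by_cases hg : g ∈ N
  · exact N.mul_mem (N.mul_mem hg hm) (N.inv_mem hg)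
  · exact h.mul_inv_mem _ (fun hgm => hg ((N.mul_mem_cancel_right hm).1 hgm)) _ hg

/-- The group is generated by `N` and `x`, and `m` commutes with both. -/
theorem mem_center (h : IsAbelianOfIndexLeTwo N) {m x : G} (hm : m ∈ N) (hx : x ∉ N)
    (hc : m * x = x * m) : m ∈ Subgroup.center G := by
  rw [Subgroup.mem_center_iff]
  intro y
  by_cases hy : y ∈ N
  · exact h.comm y hy m hm
  · have := h.comm _ (h.mul_inv_mem y hy x hx) m hm
    calc y * m = y * x⁻¹ * (x * m) := by group
      _ = y * x⁻¹ * m * x := by rw [← hc]; simp only [mul_assoc]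
      _ = m * y := by rw [this]; group

/-- Off the subgroup, commuting elements differ by a central factor. -/
theorem mul_inv_mem_center (h : IsAbelianOfIndexLeTwo N) {x y : G} (hx : x ∉ N) (hy : y ∉ N)
    (hc : x * y = y * x) : y * x⁻¹ ∈ Subgroup.center G := by
  refine h.mem_center (h.mul_inv_mem y hy x hx) hx ?_
  rw [inv_mul_cancel_right, ← mul_assoc, hc, mul_inv_cancel_right]

theorem notMem_of_commute (h : IsAbelianOfIndexLeTwo N) {x y : G} (hx : x ∉ N)
    (hy : y ∉ Subgroup.center G) (hc : x * y = y * x) : y ∉ N :=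
  fun hyN => hy (h.mem_center hyN hx hc.symm)

end IsAbelianOfIndexLeTwo

/-! ### The three super commuting graphs -/

theorem superCommGraph_adj_of_comm {G : Type*} [Group G] (B : Setoid G) {g h : G} (hne : g ≠ h)
    (hc : g * h = h * g) : (superCommGraph B).Adj g h :=
  ⟨hne, Or.inr ⟨g, h, B.refl g, B.refl h, hc⟩⟩

/-- With `Z` the center, a noncentral `u` has centralizer `N` if `u ∈ N`, and `Z ∪ uZ` otherwise.
Both are abelian, so commuting is transitive on noncentral elements. -/
theorem IsAbelianOfIndexLeTwo.hansenVukicevic_ESCom {G : Type*} [Group G] [Fintype G]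
    {N : Subgroup G} (h : IsAbelianOfIndexLeTwo N) : HansenVukicevic (ESCom G) := by
  classical
  have hadj : ∀ u v : G, (ESCom G).Adj u v → u * v = v * u := by
    rintro u v ⟨-, huv | ⟨u', v', hu, hv, hc⟩⟩
    · have : u = v := huv
      rw [this]
    · have h1 : u = u' := hu
      have h2 : v = v' := hv
      rwa [h1, h2]
  refine hansenVukicevic_of_join_cliques _ (Finset.univ.filter (· ∈ Subgroup.center G))
    ⟨1, by simp⟩ ?_ ?_
  · intro u hu v huv
    rw [Finset.mem_filter] at hu
    exact superCommGraph_adj_of_comm _ huv (Subgroup.mem_center_iff.1 hu.2 v).symm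
  · intro u v w hu hv hw huv huw hvw
    simp only [Finset.mem_filter, Finset.mem_univ, true_and] at hu hv hw
    have cuv := hadj u v huv
    have cuw := hadj u w huw
    refine superCommGraph_adj_of_comm _ hvw ?_
    by_cases huN : u ∈ N
    · have hvN : v ∈ N := by
        by_contra hvN; exact h.notMem_of_commute hvN hu cuv.symm huN
      have hwN : w ∈ N := by
        by_contra hwN; exact h.notMem_of_commute hwN hu cuw.symm huN
      exact h.comm v hvN w hwN
    · have hz := h.mul_inv_mem_center huN (h.notMem_of_commute huN hv cuv) cuv
      rw [Subgroup.mem_center_iff] at hz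
      calc v * w = v * u⁻¹ * (u * w) := by group
        _ = v * u⁻¹ * w * u := by rw [cuw]; group
        _ = w * v := by rw [← hz w]; group

/-- Normality of `N` keeps each conjugacy class inside `N` or outside it. The noncentral part of `N`
is one clique; outside `N`, adjacent noncentral elements are conjugate up to a central factor, which
is a transitive relation. -/
theorem IsAbelianOfIndexLeTwo.hansenVukicevic_CSCom {G : Type*} [Group G] [Fintype G]
    {N : Subgroup G} (h : IsAbelianOfIndexLeTwo N) : HansenVukicevic (CSCom G) := by
  classical
  have hN := h.normal
  have hconj : ∀ {x y : G}, IsConj x y → (x ∈ N ↔ y ∈ N) := by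
    intro x y hxy
    obtain ⟨g, rfl⟩ := isConj_iff.1 hxy
    exact hN.mem_comm_iff.trans (by rw [← mul_assoc, inv_mul_cancel, one_mul]) |>.symm
  have hcen : ∀ {x y : G}, IsConj x y → x ∉ Subgroup.center G → y ∉ Subgroup.center G := by
    intro x y hxy hx hy
    obtain ⟨g, rfl⟩ := isConj_iff.1 hxy
    refine hx ?_
    have := (inferInstance : (Subgroup.center G).Normal).conj_mem _ hy g⁻¹
    simpa [mul_assoc] using this
  have hadj : ∀ u v : G, u ∉ Subgroup.center G → v ∉ Subgroup.center G → (CSCom G).Adj u v →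
      (u ∈ N ∧ v ∈ N) ∨ (u ∉ N ∧ v ∉ N ∧ ∃ z ∈ Subgroup.center G, IsConj v (u * z)) := by
    rintro u v hu hv ⟨-, huv | ⟨u', v', hu', hv', hc⟩⟩
    · have huv : IsConj u v := huv
      by_cases huN : u ∈ N
      · exact Or.inl ⟨huN, (hconj huv).1 huN⟩
      · exact Or.inr ⟨huN, fun hvN => huN ((hconj huv).2 hvN), 1, Subgroup.one_mem _, by
          rw [mul_one]; exact huv.symm⟩
    · have hu' : IsConj u u' := hu'
      have hv' : IsConj v v' := hv'
      by_cases huN : u' ∈ N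
      · refine Or.inl ⟨(hconj hu').2 huN, (hconj hv').2 ?_⟩
        by_contra hvN
        exact h.notMem_of_commute hvN (hcen hu' hu) hc.symm huN
      · have hvN := h.notMem_of_commute huN (hcen hv' hv) hc
        refine Or.inr ⟨fun hh => huN ((hconj hu').1 hh), fun hh => hvN ((hconj hv').1 hh),
          v' * u'⁻¹, h.mul_inv_mem_center huN hvN hc, hv'.trans ?_⟩
        obtain ⟨g, rfl⟩ := isConj_iff.1 hu'
        have hz := h.mul_inv_mem_center huN hvN hc
        rw [Subgroup.mem_center_iff] at hz
        -- The central factor passes through conjugation by `g`, which carries `u` to `u'`.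
        refine IsConj.symm (isConj_iff.2 ⟨g, ?_⟩)
        calc g * (u * (v' * (g * u * g⁻¹)⁻¹)) * g⁻¹
            = g * u * ((v' * (g * u * g⁻¹)⁻¹) * g⁻¹) := by simp only [mul_assoc]
          _ = (g * u * g⁻¹) * (v' * (g * u * g⁻¹)⁻¹) := by rw [← hz g⁻¹]; simp only [mul_assoc]
          _ = v' := by rw [hz]; group
  refine hansenVukicevic_of_join_cliques _ (Finset.univ.filter (· ∈ Subgroup.center G))
    ⟨1, by simp⟩ ?_ ?_
  · intro u hu v huv
    rw [Finset.mem_filter] at hu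
    exact superCommGraph_adj_of_comm _ huv (Subgroup.mem_center_iff.1 hu.2 v).symm
  · intro u v w hu hv hw huv huw hvw
    simp only [Finset.mem_filter, Finset.mem_univ, true_and] at hu hv hw
    rcases hadj u v hu hv huv with ⟨huN, hvN⟩ | ⟨huN, hvN, z, hz, hvz⟩
    · rcases hadj u w hu hw huw with ⟨_, hwN⟩ | ⟨huN', _⟩
      · exact superCommGraph_adj_of_comm _ hvw (h.comm v hvN w hwN)
      · exact absurd huN huN'
    · rcases hadj u w hu hw huw with ⟨huN', _⟩ | ⟨_, _, y, hy, hwy⟩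
      · exact absurd huN' huN
      · refine ⟨hvw, Or.inr ⟨u * z, u * y, hvz, hwy, ?_⟩⟩
        rw [Subgroup.mem_center_iff] at hz hy
        calc u * z * (u * y) = u * (z * u * y) := by simp only [mul_assoc]
          _ = u * y * (u * z) := by rw [← hz u, hy (u * z)]; simp only [mul_assoc]

/-- Off `C`, the elements of `N` form a clique, and so do those outside `N`, all of order 4. If `N`
has an element of order 4, the two cliques merge; otherwise no edge joins them. -/
theorem IsAbelianOfIndexLeTwo.hansenVukicevic_OSCom {G : Type*} [Group G] [Fintype G]
    {N : Subgroup G} (h : IsAbelianOfIndexLeTwo N) (h4 : ∀ x ∉ N, x ^ 4 = 1) {z : G}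
    (hz : z ∈ Subgroup.center G) (hz2 : orderOf z = 2) : HansenVukicevic (OSCom G) := by
  classical
  have hdvd : ∀ {m : ℕ}, m ∣ 4 → m ∣ 2 ∨ m = 4 := by
    intro m hm
    have := Nat.le_of_dvd (by norm_num) hm
    interval_cases m <;> simp_all
  have hone : ∀ {m : ℕ}, m ∣ 2 → m = 1 ∨ m = 2 := fun hm => (Nat.dvd_prime Nat.prime_two).1 hm
  have hout : ∀ x ∉ N, ¬ orderOf x ∣ 2 → orderOf x = 4 := fun x hx hx2 =>
    (hdvd (orderOf_dvd_of_pow_eq_one (h4 x hx))).resolve_left hx2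
  refine hansenVukicevic_of_join_cliques _ (Finset.univ.filter fun x => orderOf x ∣ 2)
    ⟨1, by simp⟩ ?_ ?_
  · intro u hu v huv
    rw [Finset.mem_filter] at hu
    rcases hone hu.2 with h1 | h2
    · rw [orderOf_eq_one_iff] at h1
      exact superCommGraph_adj_of_comm _ huv (by rw [h1, one_mul, mul_one])
    -- An involution need not be central, but its class contains the central `z`.
    · exact ⟨huv, Or.inr ⟨z, v, h2.trans hz2.symm, rfl, (Subgroup.mem_center_iff.1 hz v).symm⟩⟩
  · intro u v w hu hv hw huv huw hvw
    simp only [Finset.mem_filter, Finset.mem_univ, true_and] at hu hv hw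
    have same : ∀ {x y : G}, x ≠ y → ¬ orderOf x ∣ 2 → ¬ orderOf y ∣ 2 → (x ∈ N ↔ y ∈ N) →
        (OSCom G).Adj x y := by
      intro x y hxy hx hy hiff
      by_cases hxN : x ∈ N
      · exact superCommGraph_adj_of_comm _ hxy (h.comm x hxN y (hiff.1 hxN))
      · exact ⟨hxy, Or.inl ((hout x hxN hx).trans
          (hout y (fun hyN => hxN (hiff.2 hyN)) hy).symm)⟩
    by_cases hex : ∃ y ∈ N, orderOf y = 4
    · obtain ⟨y, hyN, hy4⟩ := hex
      by_cases hiff : v ∈ N ↔ w ∈ N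
      · exact same hvw hv hw hiff
      by_cases hvN : v ∈ N
      · have hwN : w ∉ N := fun hwN => hiff ⟨fun _ => hwN, fun _ => hvN⟩
        exact ⟨hvw, Or.inr ⟨v, y, rfl, (hout w hwN hw).trans hy4.symm, h.comm v hvN y hyN⟩⟩
      · have hwN : w ∈ N := by
          by_contra hwN; exact hiff ⟨fun h => absurd h hvN, fun h => absurd h hwN⟩
        exact ⟨hvw, Or.inr ⟨y, w, (hout v hvN hv).trans hy4.symm, rfl, h.comm y hyN w hwN⟩⟩
    · push Not at hex
      have hiff4 : ∀ x, ¬ orderOf x ∣ 2 → (x ∈ N ↔ orderOf x ≠ 4) := fun x hx =>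
        ⟨hex x, fun hx4 => by by_contra hxN; exact hx4 (hout x hxN hx)⟩
      -- Both `x` and `x * y` lie outside `N`, so if they commute then `y ^ 4 = 1`, which makes `y`
      -- an element of order 4 in `N`.
      have hcross : ∀ x y : G, x ∉ N → y ∈ N → ¬ orderOf y ∣ 2 → x * y = y * x → False := by
        intro x y hx hy hy2 hc
        have hxy : x * y ∉ N := fun hh => hx ((N.mul_mem_cancel_right hy).1 hh)
        have hp : y ^ 4 = 1 := by
          have := h4 _ hxy
          rwa [(show Commute x y from hc).mul_pow, h4 x hx, one_mul] at this
        exact (hdvd (orderOf_dvd_of_pow_eq_one hp)).elim hy2 (hex y hy)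
      have hadj : ∀ x y : G, ¬ orderOf x ∣ 2 → ¬ orderOf y ∣ 2 → (OSCom G).Adj x y →
          (x ∈ N ↔ y ∈ N) := by
        rintro x y hx hy ⟨-, hxy | ⟨x', y', hx', hy', hc⟩⟩
        · have hxy : orderOf x = orderOf y := hxy
          rw [hiff4 x hx, hiff4 y hy, hxy]
        · have hx' : orderOf x = orderOf x' := hx'
          have hy' : orderOf y = orderOf y' := hy'
          rw [hiff4 x hx, hiff4 y hy, hx', hy']
          rw [hx'] at hx
          rw [hy'] at hy
          rw [← hiff4 x' hx, ← hiff4 y' hy]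
          exact ⟨fun hxN => by by_contra hyN; exact hcross y' x' hyN hxN hx hc.symm,
            fun hyN => by by_contra hxN; exact hcross x' y' hxN hyN hy hc⟩
      exact same hvw hv hw ((hadj u v hu hv huv).symm.trans (hadj u w hu hw huw))

/-! ### The structure of `V_{8n}` -/

namespace V8n

variable (n : ℕ)

theorem relations : ∃ a b : V8n n, a = PresentedGroup.of 0 ∧ b = PresentedGroup.of 1 ∧
    b ^ 4 = 1 ∧ b * a = a⁻¹ * b⁻¹ ∧ b⁻¹ * a = a⁻¹ * b := by
  have hrel : ∀ r ∈ V8nRels n, PresentedGroup.mk (V8nRels n) r = 1 := fun r hr =>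
    PresentedGroup.one_of_mem hr
  refine ⟨_, _, rfl, rfl, ?_, ?_, ?_⟩
  · have := hrel (FreeGroup.of 1 ^ 4) (by simp [V8nRels])
    rwa [map_pow] at this
  · have := hrel ((FreeGroup.of 1 * FreeGroup.of 0) *
      ((FreeGroup.of 0)⁻¹ * (FreeGroup.of 1)⁻¹)⁻¹) (by simp [V8nRels])
    rwa [map_mul, map_inv, mul_inv_eq_one, map_mul, map_mul, map_inv, map_inv] at this
  · have := hrel (((FreeGroup.of 1)⁻¹ * FreeGroup.of 0) *
      ((FreeGroup.of 0)⁻¹ * FreeGroup.of 1)⁻¹) (by simp [V8nRels])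
    rwa [map_mul, map_inv, mul_inv_eq_one, map_mul, map_mul, map_inv, map_inv] at this

/-- The homomorphism to the dihedral group of order eight that sends `a` to a reflection and `b`
to a rotation of order four. -/
def toDihedral : V8n n →* DihedralGroup 4 :=
  PresentedGroup.toGroup (f := ![DihedralGroup.sr 0, DihedralGroup.r 1]) (by
    intro r hr
    rcases hr with rfl | rfl | rfl | rfl
    · simp only [pow_mul, map_pow, FreeGroup.lift_apply_of]
      -- The exponent of `a` is even, and a reflection squares to 1.
      exact (congrArg (· ^ n) (by decide)).trans (one_pow n)
    · simp only [map_pow, FreeGroup.lift_apply_of]; decide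
    · simp only [map_mul, map_inv, FreeGroup.lift_apply_of]; decide
    · simp only [map_mul, map_inv, FreeGroup.lift_apply_of]; decide)

/-- A presentation gives only upper bounds on orders; the dihedral quotient shows that `b ^ 2`
survives. -/
theorem of_one_sq_ne_one : (PresentedGroup.of 1 : V8n n) ^ 2 ≠ 1 := by
  intro h
  have := congrArg (toDihedral n) h
  rw [map_pow, map_one, toDihedral, PresentedGroup.toGroup.of] at this
  revert this
  simp only [Matrix.cons_val_one, Matrix.cons_val_fin_one]
  decide

/-- The structure of `V_{8n}` used below: an abelian subgroup of index at most two, with every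
element outside it killed by `4`, and a central involution. -/
theorem exists_isAbelianOfIndexLeTwo : ∃ N : Subgroup (V8n n), IsAbelianOfIndexLeTwo N ∧
    (∀ x ∉ N, x ^ 4 = 1) ∧ ∃ z ∈ Subgroup.center (V8n n), orderOf z = 2 := by
  obtain ⟨a, b, ha, hb, hb4, h3, h4⟩ := relations n
  have hz1 : b ^ 2 ≠ 1 := by rw [hb]; exact of_one_sq_ne_one n
  have hz2 : b ^ 2 * b ^ 2 = 1 := by rw [← pow_add]; exact hb4
  have e1 : b * a * b = a⁻¹ := by rw [h3]; group
  have e2 : b⁻¹ * a * b⁻¹ = a⁻¹ := by rw [h4]; group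
  have hza : a * b ^ 2 = b ^ 2 * a := by
    have e3 : b ^ 2 * a * b ^ 2 = a := by
      calc b ^ 2 * a * b ^ 2 = b * (b * a * b) * b := by simp only [pow_two, mul_assoc]
        _ = b * (b⁻¹ * a * b⁻¹) * b := by rw [e1, e2]
        _ = a := by group
    calc a * b ^ 2 = b ^ 2 * a * b ^ 2 * b ^ 2 := by rw [e3]
      _ = b ^ 2 * a * (b ^ 2 * b ^ 2) := by group
      _ = b ^ 2 * a := by rw [hz2, mul_one]
  have hconj : b⁻¹ * a * b = a⁻¹ * b ^ 2 := by rw [h4, mul_assoc, pow_two]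
  have hgen : ∀ H : Subgroup (V8n n), a ∈ H → b ∈ H → ∀ x, x ∈ H := by
    intro H haH hbH
    refine PresentedGroup.generated_by _ H fun j => ?_
    fin_cases j
    · exact ha ▸ haH
    · exact hb ▸ hbH
  have hzc : b ^ 2 ∈ Subgroup.center (V8n n) := by
    rw [Subgroup.mem_center_iff]
    intro g
    have := hgen (Subgroup.centralizer {b ^ 2})
      (by rw [Subgroup.mem_centralizer_singleton_iff]; exact hza)
      (by rw [Subgroup.mem_centralizer_singleton_iff]; group) g
    rwa [Subgroup.mem_centralizer_singleton_iff] at this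
  set N : Subgroup (V8n n) := Subgroup.closure {a, b ^ 2} with hN
  have haN : a ∈ N := Subgroup.subset_closure (by simp)
  have hzN : b ^ 2 ∈ N := Subgroup.subset_closure (by simp)
  have hcomm : ∀ x ∈ N, ∀ y ∈ N, x * y = y * x := by
    have : IsMulCommutative N := by
      refine Subgroup.isMulCommutative_closure ?_
      rintro x (rfl | rfl) y (rfl | rfl)
      · rfl
      · exact hza
      · exact hza.symm
      · rfl
    exact fun x hx y hy => congrArg Subtype.val (mul_comm' (⟨x, hx⟩ : N) ⟨y, hy⟩)
  -- On the abelian group `N` the map `m ↦ (b⁻¹ m b m)²` is multiplicative, so it suffices that it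
  -- kills the generators. For `m = a` the inner product is `b ^ 2`.
  have hconjN : ∀ m ∈ N, b⁻¹ * m * b ∈ N ∧ (b⁻¹ * m * b * m) ^ 2 = 1 := by
    intro m hm
    induction hm using Subgroup.closure_induction with
    | mem x hx =>
      rcases hx with rfl | rfl
      · rw [hconj]
        refine ⟨N.mul_mem (N.inv_mem haN) hzN, ?_⟩
        rw [mul_assoc, ← hza, inv_mul_cancel_left, pow_two, hz2]
      · have : b⁻¹ * b ^ 2 * b = b ^ 2 := by group
        rw [this]
        exact ⟨hzN, by rw [hz2, one_pow]⟩
    | one => exact ⟨by simp, by simp⟩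
    | mul x y hx hy ihx ihy =>
      have hxy : b⁻¹ * (x * y) * b = (b⁻¹ * x * b) * (b⁻¹ * y * b) := by group
      rw [hxy]
      refine ⟨N.mul_mem ihx.1 ihy.1, ?_⟩
      have : b⁻¹ * x * b * (b⁻¹ * y * b) * (x * y) =
          (b⁻¹ * x * b * x) * (b⁻¹ * y * b * y) := by
        rw [mul_assoc, ← mul_assoc _ x y, hcomm _ ihy.1 x hx]; simp only [mul_assoc]
      rw [this, (show Commute _ _ from hcomm _ (N.mul_mem ihx.1 hx) _
        (N.mul_mem ihy.1 hy)).mul_pow, ihx.2, ihy.2, one_mul]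
    | inv x hx ih =>
      have hxi : b⁻¹ * x⁻¹ * b = (b⁻¹ * x * b)⁻¹ := by group
      rw [hxi]
      refine ⟨N.inv_mem ih.1, ?_⟩
      rw [← mul_inv_rev, ← hcomm _ ih.1 x hx, inv_pow, ih.2, inv_one]
  have hcover : ∀ x : V8n n, x ∈ N ∨ b⁻¹ * x ∈ N := by
    -- The union of `N` and `bN` is a subgroup containing both generators.
    let H : Subgroup (V8n n) :=
      { carrier := {x | x ∈ N ∨ b⁻¹ * x ∈ N}
        one_mem' := Or.inl N.one_mem
        mul_mem' := by
          rintro x y (hx | hx) (hy | hy)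
          · exact Or.inl (N.mul_mem hx hy)
          · refine Or.inr ?_
            have := N.mul_mem (hconjN x hx).1 hy
            rwa [show b⁻¹ * x * b * (b⁻¹ * y) = b⁻¹ * (x * y) by group] at this
          · refine Or.inr ?_
            have := N.mul_mem hx hy
            rwa [mul_assoc] at this
          · refine Or.inl ?_
            have := N.mul_mem hzN (N.mul_mem (hconjN _ hx).1 hy)
            rwa [show b ^ 2 * (b⁻¹ * (b⁻¹ * x) * b * (b⁻¹ * y)) = x * y by group] at this
        inv_mem' := by
          rintro x (hx | hx)
          · exact Or.inl (N.inv_mem hx)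
          · refine Or.inr ?_
            have := N.mul_mem (hconjN _ (N.inv_mem hx)).1 (N.inv_mem hzN)
            rwa [show b⁻¹ * (b⁻¹ * x)⁻¹ * b * (b ^ 2)⁻¹ = b⁻¹ * x⁻¹ by group] at this }
    exact hgen H (Or.inl haN) (Or.inr (by rw [inv_mul_cancel]; exact N.one_mem))
  refine ⟨N, ⟨hcomm, fun x hx y hy => ?_⟩, fun x hx => ?_, b ^ 2, hzc, ?_⟩
  · have hx := (hcover x).resolve_left hx
    have hy := (hcover y).resolve_left hy
    have := (hconjN _ (N.mul_mem hx (N.inv_mem hy))).1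
    have := N.mul_mem (N.mul_mem hzN this) (N.inv_mem hzN)
    rwa [show b ^ 2 * (b⁻¹ * (b⁻¹ * x * (b⁻¹ * y)⁻¹) * b) * (b ^ 2)⁻¹ = x * y⁻¹ by group] at this
  · have hx := (hcover x).resolve_left hx
    obtain ⟨h1, h2⟩ := hconjN _ hx
    -- With `x = b m` and `m ∈ N`, `x ^ 2` is the product of `b ^ 2` and `b⁻¹ m b m`, two commuting
    -- elements of square 1.
    have hsq : x ^ 2 = b ^ 2 * (b⁻¹ * (b⁻¹ * x) * b * (b⁻¹ * x)) := by rw [pow_two x]; group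
    rw [show x ^ 4 = (x ^ 2) ^ 2 by rw [← pow_mul], hsq,
      (show Commute _ _ from hcomm _ hzN _ (N.mul_mem h1 hx)).mul_pow, h2, mul_one, pow_two, hz2]
  · exact orderOf_eq_prime (by rw [pow_two, hz2]) hz1

end V8n

theorem mainTheorem3 (n : ℕ) [NeZero n] :
    HansenVukicevic (ESCom (V8n n)) ∧
      HansenVukicevic (CSCom (V8n n)) ∧
      HansenVukicevic (OSCom (V8n n)) := by
  obtain ⟨N, hN, h4, z, hz, hz2⟩ := V8n.exists_isAbelianOfIndexLeTwo n
  exact ⟨hN.hansenVukicevic_ESCom, hN.hansenVukicevic_CSCom, hN.hansenVukicevic_OSCom h4 hz hz2⟩
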